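/- Let $n\ge 1$ and let $\Omega\subset\mathbb{R}^n$ be a bounded domain (a nonempty bounded connected open set). Consider the clamped plate problem $$\Delta^2 w=\Gamma w\ \text{ in }\Omega,\qquad w=\frac{\partial w}{\partial n}=0\ \text{ on }\partial\Omega,$$ understood weakly: $w\in H^2_0(\Omega)$ (the closure of $C_c^\infty(\Omega)$ in the $H^2$-norm, real-valued functions) and $\Delta^2w=\Gamma w$ in the sense of distributions on $\Omega$. Let $\Gamma_1\le\Gamma_2\le\Gamma_3\le\cdots$ be its eigenvalues, listed in nondecreasing order and repeated according to multiplicity. Then for every $m=1,2,\dots$ $$\Gamma_{m+1}-\Gamma_m\le\frac{8(n+2)}{n^2m^2}\Bigl(\Gamma_1^{1/2}+\cdots+\Gamma_m^{1/2}\Bigr)^2 .$$ Moreover, this is at least as sharp as the Payne–Pólya–Weinberger bound $\Gamma_{m+1}-\Gamma_m\le\frac{8(n+2)}{n^2m}(\Gamma_1+\cdots+\Gamma_m)$, in the sense that $$\frac{8(n+2)}{n^2m^2}\Bigl(\Gamma_1^{1/2}+\cdots+\Gamma_m^{1/2}\Bigr)^2\le\frac{8(n+2)}{n^2m}\,(\Gamma_1+\cdots+\Gamma_m).$$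 -/

import Mathlib

open MeasureTheory Topology
open scoped ContDiff InnerProductSpace Laplacian

noncomputable section

namespace ClampedPlate

/-- `n`-dimensional Euclidean space. -/
abbrev E (n : ℕ) := EuclideanSpace ℝ (Fin n)

/-- The real Hilbert space `L²(Ω)` (Lebesgue measure restricted to `Ω`). -/
abbrev L2 {n : ℕ} (Ω : Set (E n)) := Lp ℝ 2 (volume.restrict Ω)

/-- The test functions `C_c^∞(Ω)`: smooth functions on `ℝⁿ` with compact support inside `Ω`. -/
def testFunctions {n : ℕ} (Ω : Set (E n)) : Submodule ℝ (E n → ℝ) where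
  carrier := {φ | ContDiff ℝ ∞ φ ∧ HasCompactSupport φ ∧ tsupport φ ⊆ Ω}
  zero_mem' := by
    refine ⟨contDiff_const, HasCompactSupport.zero, ?_⟩
    simp [tsupport]
  add_mem' := by
    rintro φ ψ ⟨h1, h2, h3⟩ ⟨k1, k2, k3⟩
    exact ⟨h1.add k1, h2.add k2, (tsupport_add φ ψ).trans (Set.union_subset h3 k3)⟩
  smul_mem' := by
    rintro c φ ⟨h1, h2, h3⟩
    exact ⟨h1.const_smul c, h2.smul_left (f := fun _ => c),
      (tsupport_smul_subset_right (fun _ => c) φ).trans h3⟩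

variable {n : ℕ} {Ω : Set (E n)}

/-- The partial derivative `∂φ/∂x_i` of a test function, again a test function. -/
def pd (i : Fin n) : testFunctions Ω →ₗ[ℝ] testFunctions Ω where
  toFun φ := ⟨fun x => fderiv ℝ (φ : E n → ℝ) x (EuclideanSpace.single i 1),
    (φ.2.1.fderiv_right (m := ∞) le_rfl).clm_apply contDiff_const,
    φ.2.2.1.fderiv_apply (𝕜 := ℝ) _,
    (tsupport_fderiv_apply_subset ℝ _).trans φ.2.2.2⟩
  map_add' φ ψ := by
    ext x
    have h1 := (φ.2.1.differentiable (by simp)) x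
    have h2 := (ψ.2.1.differentiable (by simp)) x
    simp [fderiv_add h1 h2]
  map_smul' c φ := by
    ext x
    have h1 := (φ.2.1.differentiable (by simp)) x
    simp [fderiv_const_smul h1]

lemma memLp_test (φ : testFunctions Ω) :
    MemLp (φ : E n → ℝ) 2 (volume.restrict Ω) :=
  φ.2.1.continuous.memLp_of_hasCompactSupport φ.2.2.1

/-- A test function as an element of `L²(Ω)`. -/
def toL2 : testFunctions Ω →ₗ[ℝ] L2 Ω where
  toFun φ := (memLp_test φ).toLp _
  map_add' φ ψ := MemLp.toLp_add (memLp_test φ) (memLp_test ψ)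
  map_smul' c φ := MemLp.toLp_const_smul c (memLp_test φ)

/-- The space in which triples `(u, ∇u, D²u)` with square-integrable entries live.
Its product norm induces on such triples the topology of the `H²(Ω)`-norm. -/
abbrev Jet (Ω : Set (E n)) := L2 Ω × (Fin n → L2 Ω) × (Fin n → Fin n → L2 Ω)

/-- `φ ↦ (φ, (∂_i φ)_i, (∂_j ∂_i φ)_{i,j})`. -/
def jet : testFunctions Ω →ₗ[ℝ] Jet Ω :=
  toL2.prod ((LinearMap.pi fun i => toL2 ∘ₗ pd i).prod
    (LinearMap.pi fun i => LinearMap.pi fun j => toL2 ∘ₗ pd j ∘ₗ pd i))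

/-- The Sobolev space `H²₀(Ω)`, as a subspace of `L²(Ω)`: the closure of `C_c^∞(Ω)` in the
`H²(Ω)`-norm, i.e. the functions `u ∈ L²(Ω)` for which there are test functions `φ_k` such that
`φ_k → u` in `L²(Ω)` and all first and second partial derivatives of `φ_k` converge in `L²(Ω)`.
(The limits are the weak derivatives of `u`, see `weak_deriv_fst` and `weak_deriv_snd`.) -/
def H20 (Ω : Set (E n)) : Submodule ℝ (L2 Ω) :=
  (LinearMap.range (jet (Ω := Ω))).topologicalClosure.map (LinearMap.fst ℝ _ _)

lemma inner_toL2 (u : L2 Ω) (φ : testFunctions Ω) :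
    ⟪toL2 φ, u⟫_ℝ = ∫ x in Ω, u x * (φ : E n → ℝ) x := by
  rw [MeasureTheory.L2.inner_def]
  refine integral_congr_ae ?_
  filter_upwards [(memLp_test φ).coeFn_toLp] with x hx
  have : (toL2 φ : L2 Ω) x = (φ : E n → ℝ) x := hx
  simp [this]

lemma integral_test (φ ψ : testFunctions Ω) :
    ⟪toL2 φ, toL2 ψ⟫_ℝ = ∫ x, (φ : E n → ℝ) x * (ψ : E n → ℝ) x := by
  rw [inner_toL2, ← setIntegral_eq_integral_of_forall_compl_eq_zero (s := Ω) (μ := volume)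
    (f := fun x => (φ : E n → ℝ) x * (ψ : E n → ℝ) x)]
  · refine integral_congr_ae ?_
    filter_upwards [(memLp_test ψ).coeFn_toLp] with x hx
    have : (toL2 ψ : L2 Ω) x = (ψ : E n → ℝ) x := hx
    rw [this, mul_comm]
  · intro x hx
    have : (φ : E n → ℝ) x = 0 :=
      image_eq_zero_of_notMem_tsupport fun h => hx (φ.2.2.2 h)
    simp [this]

lemma integral_by_parts (φ ψ : testFunctions Ω) (i : Fin n) :
    ⟪toL2 (pd i ψ), toL2 φ⟫_ℝ = - ⟪toL2 ψ, toL2 (pd i φ)⟫_ℝ := by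
  have hint : ∀ a b : testFunctions Ω,
      Integrable (fun x => (a : E n → ℝ) x * (b : E n → ℝ) x) := fun a b =>
    (a.2.1.continuous.mul b.2.1.continuous).integrable_of_hasCompactSupport a.2.2.1.mul_right
  rw [integral_test, integral_test, eq_neg_iff_add_eq_zero, ← eq_neg_iff_add_eq_zero]
  have h := integral_mul_fderiv_eq_neg_fderiv_mul_of_integrable (𝕜 := ℝ) (μ := volume)
    (f := (ψ : E n → ℝ)) (g := (φ : E n → ℝ)) (v := EuclideanSpace.single i 1)
    (hint (pd i ψ) φ) (hint ψ (pd i φ)) (hint ψ φ)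
    (fun x _ => (ψ.2.1.differentiable (by simp)) x)
    (fun x _ => (φ.2.1.differentiable (by simp)) x)
  exact neg_eq_iff_eq_neg.mp h.symm

/-- In the closure of the triples `(φ, ∇φ, D²φ)`, the second entry is the weak gradient of the
first one. -/
lemma weak_deriv_fst {J : Jet Ω} (hJ : J ∈ (LinearMap.range (jet (Ω := Ω))).topologicalClosure)
    (i : Fin n) (ψ : testFunctions Ω) :
    ∫ x in Ω, J.1 x * (pd i ψ : E n → ℝ) x = - ∫ x in Ω, J.2.1 i x * (ψ : E n → ℝ) x := by
  rw [← inner_toL2, ← inner_toL2]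
  have hcl : IsClosed {J : Jet Ω | ⟪toL2 (pd i ψ), J.1⟫_ℝ = - ⟪toL2 ψ, J.2.1 i⟫_ℝ} :=
    isClosed_eq (by fun_prop) (by fun_prop)
  refine closure_minimal ?_ hcl hJ
  rintro _ ⟨φ, rfl⟩
  exact integral_by_parts φ ψ i

/-- In the closure of the triples `(φ, ∇φ, D²φ)`, the third entry is the weak derivative of the
second one. -/
lemma weak_deriv_snd {J : Jet Ω} (hJ : J ∈ (LinearMap.range (jet (Ω := Ω))).topologicalClosure)
    (i j : Fin n) (ψ : testFunctions Ω) :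
    ∫ x in Ω, J.2.1 i x * (pd j ψ : E n → ℝ) x
      = - ∫ x in Ω, J.2.2 i j x * (ψ : E n → ℝ) x := by
  rw [← inner_toL2, ← inner_toL2]
  have hcl : IsClosed {J : Jet Ω | ⟪toL2 (pd j ψ), J.2.1 i⟫_ℝ = - ⟪toL2 ψ, J.2.2 i j⟫_ℝ} :=
    isClosed_eq (by fun_prop) (by fun_prop)
  refine closure_minimal ?_ hcl hJ
  rintro _ ⟨φ, rfl⟩
  exact integral_by_parts (pd i φ) ψ j

lemma laplacian_test (φ : testFunctions Ω) :
    Δ (φ : E n → ℝ) = ((∑ i, pd i (pd i φ) : testFunctions Ω) : E n → ℝ) := by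
  funext x
  rw [InnerProductSpace.laplacian_eq_iteratedFDeriv_orthonormalBasis _
    (EuclideanSpace.basisFun (Fin n) ℝ)]
  simp only [AddSubmonoidClass.coe_finsetSum, Finset.sum_apply, EuclideanSpace.basisFun_apply,
    iteratedFDeriv_two_apply]
  refine Finset.sum_congr rfl fun i _ => ?_
  have h : DifferentiableAt ℝ (fderiv ℝ (φ : E n → ℝ)) x :=
    ((φ.2.1.fderiv_right (m := ∞) le_rfl).differentiable (by simp)) x
  change _ = fderiv ℝ (fun y => fderiv ℝ (φ : E n → ℝ) y (EuclideanSpace.single i 1)) x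
    (EuclideanSpace.single i 1)
  rw [fderiv_clm_apply h (differentiableAt_const _)]
  simp

lemma bilaplacian_mem (φ : testFunctions Ω) : Δ (Δ (φ : E n → ℝ)) ∈ testFunctions Ω := by
  rw [laplacian_test, laplacian_test]
  exact Subtype.property _

/-- The eigenspace of the clamped plate problem on `Ω` for the number `γ`: the functions
`w ∈ H²₀(Ω)` (this is the boundary condition `w = ∂w/∂n = 0` on `∂Ω`) with `Δ²w = γ w` in `Ω`
in the sense of distributions. -/
def eigenspace (Ω : Set (E n)) (γ : ℝ) : Submodule ℝ (L2 Ω) where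
  carrier := {w | w ∈ H20 Ω ∧ ∀ φ ∈ testFunctions Ω,
    ∫ x in Ω, w x * Δ (Δ φ) x = γ * ∫ x in Ω, w x * φ x}
  zero_mem' := by
    refine ⟨Submodule.zero_mem _, fun φ hφ => ?_⟩
    rw [← inner_toL2 0 ⟨φ, hφ⟩, ← inner_toL2 0 ⟨_, bilaplacian_mem ⟨φ, hφ⟩⟩]
    simp
  add_mem' := by
    rintro u v ⟨hu, hu'⟩ ⟨hv, hv'⟩
    refine ⟨Submodule.add_mem _ hu hv, fun φ hφ => ?_⟩
    have h1 := hu' φ hφ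
    have h2 := hv' φ hφ
    rw [← inner_toL2 _ ⟨φ, hφ⟩, ← inner_toL2 _ ⟨_, bilaplacian_mem ⟨φ, hφ⟩⟩] at h1 h2 ⊢
    rw [inner_add_right, inner_add_right, h1, h2]
    ring
  smul_mem' := by
    rintro c u ⟨hu, hu'⟩
    refine ⟨Submodule.smul_mem _ c hu, fun φ hφ => ?_⟩
    have h1 := hu' φ hφ
    rw [← inner_toL2 _ ⟨φ, hφ⟩, ← inner_toL2 _ ⟨_, bilaplacian_mem ⟨φ, hφ⟩⟩] at h1 ⊢
    rw [inner_smul_right, inner_smul_right, h1]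
    ring

/-- `Γ₁ ≤ Γ₂ ≤ Γ₃ ≤ …` is the list of all eigenvalues of the clamped plate problem on `Ω`, in
nondecreasing order and repeated according to multiplicity: each real number `γ` occurs in the
list exactly as often as the dimension of its eigenspace says (so not at all if `γ` is not an
eigenvalue). -/
structure IsEigenvalueSequence (Ω : Set (E n)) (Γ : ℕ+ → ℝ) : Prop where
  monotone : Monotone Γ
  multiplicity : ∀ γ : ℝ, Module.rank ℝ (eigenspace Ω γ) = Cardinal.mk {i : ℕ+ // Γ i = γ}

end ClampedPlate

end

noncomputable section

namespace ClampedPlate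

/-! ### The Payne–Pólya–Weinberger argument in an abstract Hilbert space. -/

section Commutator

/-! Take orthonormal eigenfunctions u_1, …, u_m and let φ_ik = x_k u_i - Σ_j a_ij u_j, with a_ij =
⟨x_k u_i, u_j⟩, be the part of x_k u_i orthogonal to every u_j. Being orthogonal to the u_j, it
satisfies Γ_{m+1}‖φ_ik‖² ≤ ‖Δφ_ik‖². Commuting Δ with x_k rewrites the right side as Γ_i‖φ_ik‖² plus
a commutator term (`energy_trial`). After summation over i the symmetric a_ij meet only
antisymmetric factors and drop out. With Φ = Σ‖φ_ik‖² and G = Σ‖∇u_i‖² what remains is (Γ_{m+1} -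
Γ_m)Φ ≤ 2(n+2)G. The same cancellation gives Σ⟨φ_ik, ∂_k u_i⟩ = -nm/2, hence (nm/2)² ≤ ΦG.
Eliminating Φ leaves G², and G ≤ ΣΓ_i^{1/2} because ‖∇u‖² ≤ ‖u‖‖Δu‖. All this is
`gap_le_of_commutator_identities`.

The analytic input is that x_k preserves H²₀ (`mulJet_mem`) and that the Rayleigh quotient bound
follows from the eigenvalue list alone (`mul_norm_sq_le_norm_lap_sq`). For the latter, Rellich
compactness yields a minimizer on the orthogonal complement of the u_i. If its quotient were below
Γ_{m+1}, it would be an eigenfunction for which the multiplicities leave no room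
(`IsEigenvalueSequence.exists_eigenfunctions`). -/

lemma sum_sum_mul_eq_zero_of_symm_of_antisymm {s : Type*} [Fintype s] {a b : s → s → ℝ}
    (ha : ∀ i j, a i j = a j i) (hb : ∀ i j, b i j = - b j i) :
    ∑ i, ∑ j, a i j * b i j = 0 := by
  have h : ∑ i, ∑ j, a i j * b i j = - ∑ i, ∑ j, a i j * b i j := by
    conv_lhs => rw [Finset.sum_comm]
    rw [← Finset.sum_neg_distrib]
    refine Finset.sum_congr rfl fun i _ => ?_
    rw [← Finset.sum_neg_distrib]
    refine Finset.sum_congr rfl fun j _ => ?_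
    rw [ha j i, hb j i]
    ring
  linarith

variable {H V s : Type*} [NormedAddCommGroup H] [InnerProductSpace ℝ H] [AddCommGroup V]
  [Module ℝ V] [Fintype s]

/-- The trial vectors of the Payne–Pólya–Weinberger method: the component of `X (u i)` orthogonal
to all the `u j`. -/
def trial (ι : V →ₗ[ℝ] H) (X : V → V) (u : s → V) (i : s) : V :=
  X (u i) - ∑ j, ⟪ι (X (u i)), ι (u j)⟫_ℝ • u j

variable {ι L D : V →ₗ[ℝ] H} {X : V → V} {u : s → V} {μ : s → ℝ}

lemma inner_trial_eq_zero (hu : Orthonormal ℝ fun i => ι (u i)) (i j : s) :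
    ⟪ι (u j), ι (trial ι X u i)⟫_ℝ = 0 := by
  classical
  simp only [trial, map_sub, map_sum, map_smul, inner_sub_right, inner_sum, inner_smul_right,
    orthonormal_iff_ite.mp hu]
  simp [real_inner_comm]

lemma inner_trial_left (T : V →ₗ[ℝ] H) (w : H) (i : s) :
    ⟪T (trial ι X u i), w⟫_ℝ
      = ⟪T (X (u i)), w⟫_ℝ - ∑ j, ⟪ι (X (u i)), ι (u j)⟫_ℝ * ⟪T (u j), w⟫_ℝ := by
  simp [trial, inner_sub_left, sum_inner, inner_smul_left]

lemma inner_trial_right (T : V →ₗ[ℝ] H) (w : H) (i : s) :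
    ⟪w, T (trial ι X u i)⟫_ℝ
      = ⟪w, T (X (u i))⟫_ℝ - ∑ j, ⟪ι (X (u i)), ι (u j)⟫_ℝ * ⟪w, T (u j)⟫_ℝ := by
  simp [trial, inner_sub_right, inner_sum, inner_smul_right]

lemma inner_trial_self (hu : Orthonormal ℝ fun i => ι (u i)) (i : s) :
    ⟪ι (X (u i)), ι (trial ι X u i)⟫_ℝ = ‖ι (trial ι X u i)‖ ^ 2 := by
  rw [← real_inner_self_eq_norm_sq, inner_trial_left]
  simp [inner_trial_eq_zero hu]

/-- With φ the trial vector, ⟪L (u j), L φ⟫ = μ j ⟪ι (u j), ι φ⟫ = 0, so ‖L φ‖² = ⟪L (X (u i)), L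
φ⟫. Moving X to the other factor costs the commutator, and the eigenvalue equation evaluates the
rest. -/
lemma energy_trial (hu : Orthonormal ℝ fun i => ι (u i))
    (hsym : ∀ J J', ⟪ι (X J), ι J'⟫_ℝ = ⟪ι J, ι (X J')⟫_ℝ)
    (hXL : ∀ J J', ⟪L (X J), L J'⟫_ℝ
      = ⟪L J, L (X J')⟫_ℝ + 2 * (⟪D J, L J'⟫_ℝ - ⟪L J, D J'⟫_ℝ))
    (heig : ∀ i J, ⟪L (u i), L J⟫_ℝ = μ i * ⟪ι (u i), ι J⟫_ℝ) (i : s) :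
    ‖L (trial ι X u i)‖ ^ 2 = μ i * ‖ι (trial ι X u i)‖ ^ 2
      + 2 * (⟪D (u i), L (trial ι X u i)⟫_ℝ - ⟪L (u i), D (trial ι X u i)⟫_ℝ) := by
  rw [← inner_trial_self hu, hsym, ← heig, ← hXL, ← real_inner_self_eq_norm_sq, inner_trial_left]
  simp [heig, inner_trial_eq_zero hu]

/-- The commutator form is antisymmetric in i and j while the projection coefficients are symmetric,
so the projections contribute nothing to the sum. -/
lemma sum_commutator_trial
    (hsym : ∀ J J', ⟪ι (X J), ι J'⟫_ℝ = ⟪ι J, ι (X J')⟫_ℝ) :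
    ∑ i, (⟪D (u i), L (trial ι X u i)⟫_ℝ - ⟪L (u i), D (trial ι X u i)⟫_ℝ)
      = ∑ i, (⟪D (u i), L (X (u i))⟫_ℝ - ⟪L (u i), D (X (u i))⟫_ℝ) := by
  have h := sum_sum_mul_eq_zero_of_symm_of_antisymm
    (a := fun i j : s => ⟪ι (X (u i)), ι (u j)⟫_ℝ)
    (b := fun i j => ⟪D (u i), L (u j)⟫_ℝ - ⟪L (u i), D (u j)⟫_ℝ)
    (fun i j => by rw [hsym, real_inner_comm])
    (fun i j => by rw [real_inner_comm (D (u i)), real_inner_comm (L (u i))]; ring)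
  rw [← sub_eq_zero, ← Finset.sum_sub_distrib, ← neg_eq_zero, ← h, ← Finset.sum_neg_distrib]
  refine Finset.sum_congr rfl fun i _ => ?_
  rw [inner_trial_right, inner_trial_right]
  simp only [mul_sub, Finset.sum_sub_distrib]
  ring

lemma sum_inner_trial (hu : Orthonormal ℝ fun i => ι (u i))
    (hsym : ∀ J J', ⟪ι (X J), ι J'⟫_ℝ = ⟪ι J, ι (X J')⟫_ℝ)
    (hXD : ∀ J, ⟪ι (X J), D J⟫_ℝ = - (1 / 2) * ‖ι J‖ ^ 2)
    (hD : ∀ J J', ⟪D J, ι J'⟫_ℝ = - ⟪ι J, D J'⟫_ℝ) :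
    ∑ i, ⟪ι (trial ι X u i), D (u i)⟫_ℝ = - (1 / 2) * Fintype.card s := by
  have h := sum_sum_mul_eq_zero_of_symm_of_antisymm
    (a := fun i j : s => ⟪ι (X (u i)), ι (u j)⟫_ℝ) (b := fun i j => ⟪ι (u j), D (u i)⟫_ℝ)
    (fun i j => by rw [hsym, real_inner_comm])
    (fun i j => by rw [real_inner_comm, hD])
  simp only [inner_trial_left, Finset.sum_sub_distrib, h, hXD, hu.1]
  simp
  ring

/-- The abstract form of the Payne–Pólya–Weinberger argument for the clamped plate. The maps `ι`,
`D k`, `L` and `X k` stand for the embedding of `H²₀` in `L²`, the partial derivatives, the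
Laplacian, and the multiplication by the coordinates. -/
theorem gap_le_of_commutator_identities {n : ℕ} {D : Fin n → V →ₗ[ℝ] H} {X : Fin n → V → V}
    {A B : ℝ} (hu : Orthonormal ℝ fun i => ι (u i))
    (hsym : ∀ k J J', ⟪ι (X k J), ι J'⟫_ℝ = ⟪ι J, ι (X k J')⟫_ℝ)
    (hXL : ∀ k J J', ⟪L (X k J), L J'⟫_ℝ
      = ⟪L J, L (X k J')⟫_ℝ + 2 * (⟪D k J, L J'⟫_ℝ - ⟪L J, D k J'⟫_ℝ))
    (hω : ∀ k J, ⟪D k J, L (X k J)⟫_ℝ - ⟪L J, D k (X k J)⟫_ℝ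
      = 2 * ‖D k J‖ ^ 2 + ∑ l, ‖D l J‖ ^ 2)
    (hXD : ∀ k J, ⟪ι (X k J), D k J⟫_ℝ = - (1 / 2) * ‖ι J‖ ^ 2)
    (hD : ∀ k J J', ⟪D k J, ι J'⟫_ℝ = - ⟪ι J, D k J'⟫_ℝ)
    (hG : ∀ J, ∑ l, ‖D l J‖ ^ 2 ≤ ‖ι J‖ * ‖L J‖)
    (heig : ∀ i J, ⟪L (u i), L J⟫_ℝ = μ i * ⟪ι (u i), ι J⟫_ℝ)
    (hgap : ∀ J, (∀ i, ⟪ι (u i), ι J⟫_ℝ = 0) → B * ‖ι J‖ ^ 2 ≤ ‖L J‖ ^ 2)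
    (hμ : ∀ i, μ i ≤ A) (hAB : A ≤ B) :
    (B - A) * (n * Fintype.card s) ^ 2 ≤ 8 * (n + 2) * (∑ i, √(μ i)) ^ 2 := by
  set Φ : ℝ := ∑ k, ∑ i, ‖ι (trial ι (X k) u i)‖ ^ 2 with hΦ
  set G : ℝ := ∑ k, ∑ i, ‖D k (u i)‖ ^ 2 with hGdef
  have hG0 : 0 ≤ G := by positivity
  have hlow : (n * Fintype.card s / 2 : ℝ) ^ 2 ≤ Φ * G := by
    -- Each k contributes -(card s)/2 to the sum of inner products. Cauchy–Schwarz is applied first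
    -- to each pair, then to the sum over all pairs (k, i).
    have h1 : ∑ p : Fin n × s, ‖ι (trial ι (X p.1) u p.2)‖ * ‖D p.1 (u p.2)‖
        ≥ n * Fintype.card s / 2 := by
      have h2 : ∑ p : Fin n × s, -⟪ι (trial ι (X p.1) u p.2), D p.1 (u p.2)⟫_ℝ
          = n * Fintype.card s / 2 := by
        rw [Fintype.sum_prod_type]
        simp only [Finset.sum_neg_distrib,
          fun k => sum_inner_trial hu (hsym k) (hXD k) (hD k)]
        simp
        ring
      rw [← h2]
      exact Finset.sum_le_sum fun p _ => (neg_le_abs _).trans (abs_real_inner_le_norm _ _)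
    have h3 := Finset.sum_mul_sq_le_sq_mul_sq Finset.univ
      (fun p : Fin n × s => ‖ι (trial ι (X p.1) u p.2)‖) (fun p => ‖D p.1 (u p.2)‖)
    rw [Fintype.sum_prod_type (fun p : Fin n × s => ‖ι (trial ι (X p.1) u p.2)‖ ^ 2),
      Fintype.sum_prod_type (fun p : Fin n × s => ‖D p.1 (u p.2)‖ ^ 2)] at h3
    exact (pow_le_pow_left₀ (by positivity) h1 2).trans h3
  have hup : (B - A) * Φ ≤ 2 * (n + 2) * G := by
    have hk : ∀ k, (B - A) * ∑ i, ‖ι (trial ι (X k) u i)‖ ^ 2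
        ≤ 2 * ∑ i, (2 * ‖D k (u i)‖ ^ 2 + ∑ l, ‖D l (u i)‖ ^ 2) := by
      intro k
      simp only [← hω]
      rw [← sum_commutator_trial (hsym k), Finset.mul_sum, Finset.mul_sum]
      refine Finset.sum_le_sum fun i _ => ?_
      have h1 := energy_trial hu (hsym k) (hXL k) heig i
      have h2 := hgap _ (inner_trial_eq_zero (X := X k) hu i)
      have h3 := mul_le_mul_of_nonneg_right (hμ i) (sq_nonneg ‖ι (trial ι (X k) u i)‖)
      linarith
    rw [hΦ, Finset.mul_sum]
    refine (Finset.sum_le_sum fun k _ => hk k).trans (le_of_eq ?_)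
    simp only [Finset.sum_add_distrib, ← Finset.mul_sum]
    rw [Finset.sum_comm (f := fun i l => ‖D l (u i)‖ ^ 2), ← hGdef]
    simp
    ring
  -- For a normalized eigenvector ‖L (u i)‖ = √(μ i).
  have hGS : G ≤ ∑ i, √(μ i) := by
    rw [hGdef, Finset.sum_comm]
    refine Finset.sum_le_sum fun i _ => (hG (u i)).trans (le_of_eq ?_)
    have h1 := heig i (u i)
    rw [real_inner_self_eq_norm_sq, real_inner_self_eq_norm_sq, hu.1 i] at h1
    rw [hu.1 i, one_mul, ← Real.sqrt_sq (norm_nonneg (L (u i))), h1]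
    simp
  have h1 : (B - A) * (Φ * G) ≤ 2 * (n + 2) * G * G := by
    rw [← mul_assoc]
    exact mul_le_mul_of_nonneg_right hup hG0
  have h2 := mul_le_mul_of_nonneg_left hlow (sub_nonneg.mpr hAB)
  have h3 : G * G ≤ (∑ i, √(μ i)) ^ 2 := by
    rw [sq]
    exact mul_le_mul hGS hGS hG0 (hG0.trans hGS)
  have h4 : (2 * (n + 2) : ℝ) * (G * G) ≤ 2 * (n + 2) * (∑ i, √(μ i)) ^ 2 :=
    mul_le_mul_of_nonneg_left h3 (by positivity)
  linarith

end Commutator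

/-! ### Integration by parts and norm estimates in H²₀. -/

section Jets

variable {n : ℕ} {Ω : Set (E n)}

/-- The space of `H²`-jets of the functions in `H²₀(Ω)`. -/
abbrev jetSpace (Ω : Set (E n)) : Submodule ℝ (Jet Ω) :=
  (LinearMap.range (jet (Ω := Ω))).topologicalClosure

lemma jet_mem (φ : testFunctions Ω) : jet φ ∈ jetSpace Ω :=
  Submodule.le_topologicalClosure _ ⟨φ, rfl⟩

lemma isClosed_jetSpace : IsClosed (jetSpace Ω : Set (Jet Ω)) :=
  Submodule.isClosed_topologicalClosure _

/-- Density principle: it carries integration by parts from test functions to all of H²₀. -/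
lemma jetSpace_induction {p : Jet Ω → Prop} (hp : IsClosed {J | p J})
    (h : ∀ φ : testFunctions Ω, p (jet φ)) {J : Jet Ω} (hJ : J ∈ jetSpace Ω) : p J :=
  closure_minimal (s := (LinearMap.range (jet (Ω := Ω)) : Set (Jet Ω)))
    (by rintro _ ⟨φ, rfl⟩; exact h φ) hp hJ

/-- The Laplacian on jets. -/
def lap : Jet Ω →ₗ[ℝ] L2 Ω where
  toFun J := ∑ i, J.2.2 i i
  map_add' J J' := by simp [Finset.sum_add_distrib]
  map_smul' c J := by simp [Finset.smul_sum]

/-- The partial derivatives on jets. -/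
def grad (k : Fin n) : Jet Ω →ₗ[ℝ] L2 Ω where
  toFun J := J.2.1 k
  map_add' J J' := by simp
  map_smul' c J := by simp

lemma lap_apply (J : Jet Ω) : lap J = ∑ i, J.2.2 i i := rfl

lemma grad_apply (k : Fin n) (J : Jet Ω) : grad k J = J.2.1 k := rfl

@[fun_prop]
lemma continuous_lap : Continuous (lap : Jet Ω → L2 Ω) := by
  simp only [funext lap_apply]
  fun_prop

lemma pd_comm (i j : Fin n) (φ : testFunctions Ω) : pd i (pd j φ) = pd j (pd i φ) := by
  ext x
  have h : DifferentiableAt ℝ (fderiv ℝ (φ : E n → ℝ)) x :=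
    ((φ.2.1.fderiv_right (m := ∞) le_rfl).differentiable (by simp)) x
  have key : ∀ a b : Fin n, (pd a (pd b φ) : E n → ℝ) x
      = fderiv ℝ (fderiv ℝ (φ : E n → ℝ)) x (EuclideanSpace.single a 1)
        (EuclideanSpace.single b 1) := by
    intro a b
    change fderiv ℝ (fun y => fderiv ℝ (φ : E n → ℝ) y (EuclideanSpace.single b 1)) x
      (EuclideanSpace.single a 1) = _
    rw [fderiv_clm_apply h (differentiableAt_const _)]
    simp
  rw [key, key]
  exact ((contDiff_infty.mp φ.2.1 2).contDiffAt (x := x)).isSymmSndFDerivAt (by simp) _ _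

lemma inner_grad_left {J J' : Jet Ω} (hJ : J ∈ jetSpace Ω) (hJ' : J' ∈ jetSpace Ω) (k : Fin n) :
    ⟪J.2.1 k, J'.1⟫_ℝ = - ⟪J.1, J'.2.1 k⟫_ℝ := by
  refine jetSpace_induction (p := fun J => ⟪J.2.1 k, J'.1⟫_ℝ = - ⟪J.1, J'.2.1 k⟫_ℝ)
    (isClosed_eq (by fun_prop) (by fun_prop)) (fun φ => ?_) hJ
  refine jetSpace_induction
    (p := fun J' => ⟪(jet φ).2.1 k, J'.1⟫_ℝ = - ⟪(jet φ).1, J'.2.1 k⟫_ℝ)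
    (isClosed_eq (by fun_prop) (by fun_prop)) (fun ψ => ?_) hJ'
  exact integral_by_parts ψ φ k

lemma inner_grad_grad {J J' : Jet Ω} (hJ : J ∈ jetSpace Ω) (hJ' : J' ∈ jetSpace Ω)
    (i j : Fin n) : ⟪J.2.1 i, J'.2.1 j⟫_ℝ = - ⟪J.2.2 i j, J'.1⟫_ℝ := by
  -- A derivative of an H²₀ function need not lie in H²₀, so only J is reduced to a test function φ;
  -- then ∂_i φ has a jet of its own.
  refine jetSpace_induction (p := fun J => ⟪J.2.1 i, J'.2.1 j⟫_ℝ = - ⟪J.2.2 i j, J'.1⟫_ℝ)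
    (isClosed_eq (by fun_prop) (by fun_prop)) (fun φ => ?_) hJ
  have h := inner_grad_left (jet_mem (pd i φ)) hJ' j
  exact (neg_eq_iff_eq_neg.mpr h).symm

lemma inner_lap_self {J : Jet Ω} (hJ : J ∈ jetSpace Ω) :
    ⟪lap J, J.1⟫_ℝ = - ∑ i, ‖J.2.1 i‖ ^ 2 := by
  simp only [lap_apply, sum_inner, ← Finset.sum_neg_distrib]
  refine Finset.sum_congr rfl fun i _ => ?_
  rw [← real_inner_self_eq_norm_sq, inner_grad_grad hJ hJ, neg_neg]

lemma sum_norm_grad_sq_le {J : Jet Ω} (hJ : J ∈ jetSpace Ω) :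
    ∑ i, ‖J.2.1 i‖ ^ 2 ≤ ‖J.1‖ * ‖lap J‖ := by
  rw [← neg_neg (∑ i, _), ← inner_lap_self hJ, mul_comm]
  exact (neg_le_abs _).trans (abs_real_inner_le_norm _ _)

/-- On test functions, two integrations by parts and the symmetry of second derivatives turn
⟪∂_i∂_iφ, ∂_j∂_jφ⟫ into ‖∂_j∂_iφ‖². -/
lemma norm_lap_sq {J : Jet Ω} (hJ : J ∈ jetSpace Ω) :
    ‖lap J‖ ^ 2 = ∑ i, ∑ j, ‖J.2.2 i j‖ ^ 2 := by
  refine jetSpace_induction (p := fun J => ‖lap J‖ ^ 2 = ∑ i, ∑ j, ‖J.2.2 i j‖ ^ 2)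
    (isClosed_eq (by fun_prop) (by fun_prop)) (fun φ => ?_) hJ
  rw [← real_inner_self_eq_norm_sq, lap_apply, sum_inner]
  refine Finset.sum_congr rfl fun i _ => ?_
  rw [inner_sum]
  refine Finset.sum_congr rfl fun j _ => ?_
  rw [← real_inner_self_eq_norm_sq]
  change ⟪toL2 (pd i (pd i φ)), toL2 (pd j (pd j φ))⟫_ℝ
    = ⟪toL2 (pd j (pd i φ)), toL2 (pd j (pd i φ))⟫_ℝ
  rw [integral_by_parts, pd_comm i j (pd j φ),
    ← integral_by_parts, pd_comm i j φ]

lemma le_sum_sq {ι : Type*} [Fintype ι] (a : ι → ℝ) (i : ι) : a i ^ 2 ≤ ∑ i, a i ^ 2 :=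
  Finset.single_le_sum (f := fun i => a i ^ 2) (fun _ _ => sq_nonneg _) (Finset.mem_univ i)

/-- This makes the L² norm together with the energy control the full H² norm, so minimizing
sequences are bounded and, later, Cauchy. -/
lemma norm_le_of_mem_jetSpace {J : Jet Ω} (hJ : J ∈ jetSpace Ω) : ‖J‖ ≤ ‖J.1‖ + ‖lap J‖ := by
  have h1 := sum_norm_grad_sq_le hJ
  have h2 := norm_lap_sq hJ
  have h3 := norm_nonneg J.1
  have h4 := norm_nonneg (lap J)
  refine norm_prod_le_iff.mpr ⟨by linarith, norm_prod_le_iff.mpr ⟨?_, ?_⟩⟩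
  · refine (pi_norm_le_iff_of_nonneg (by positivity)).mpr fun i => ?_
    have h5 := le_sum_sq (fun i => ‖J.2.1 i‖) i
    exact (sq_le_sq₀ (norm_nonneg _) (by positivity)).mp (by nlinarith)
  · refine (pi_norm_le_iff_of_nonneg (by positivity)).mpr fun i =>
      (pi_norm_le_iff_of_nonneg (by positivity)).mpr fun j => ?_
    have h5 := le_sum_sq (fun p : Fin n × Fin n => ‖J.2.2 p.1 p.2‖) (i, j)
    rw [Fintype.sum_prod_type (fun p : Fin n × Fin n => ‖J.2.2 p.1 p.2‖ ^ 2), ← h2] at h5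
    exact (sq_le_sq₀ (norm_nonneg _) (by positivity)).mp (by nlinarith)

end Jets

/-! ### Multiplication by coordinates and its commutators. -/

section Multiplication

variable {n : ℕ} {Ω : Set (E n)}

lemma memLp_coord (hΩ : IsOpen Ω) (hb : Bornology.IsBounded Ω) (k : Fin n) :
    MemLp (fun x : E n => x k) ⊤ (volume.restrict Ω) := by
  obtain ⟨C, hC⟩ := hb.exists_norm_le
  refine memLp_top_of_bound (by fun_prop) C ?_
  filter_upwards [ae_restrict_mem hΩ.measurableSet] with x hx
  exact (PiLp.norm_apply_le x k).trans (hC x hx)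

/-- Multiplication by the essentially bounded function `f` on `L²(Ω)`. -/
def mulL2 {f : E n → ℝ} (hf : MemLp f ⊤ (volume.restrict Ω)) : L2 Ω →L[ℝ] L2 Ω :=
  (ContinuousLinearMap.mul ℝ ℝ).holderL (volume.restrict Ω) ⊤ 2 2 hf.toLp

lemma mulL2_coeFn {f : E n → ℝ} (hf : MemLp f ⊤ (volume.restrict Ω)) (u : L2 Ω) :
    mulL2 hf u =ᵐ[volume.restrict Ω] fun x => f x * u x := by
  filter_upwards [(ContinuousLinearMap.mul ℝ ℝ).coeFn_holder (r := 2) hf.toLp u,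
    hf.coeFn_toLp] with x h1 h2
  change (ContinuousLinearMap.mul ℝ ℝ).holder 2 hf.toLp u x = _
  rw [h1, h2]
  rfl

lemma inner_mulL2 {f : E n → ℝ} (hf : MemLp f ⊤ (volume.restrict Ω)) (u v : L2 Ω) :
    ⟪mulL2 hf u, v⟫_ℝ = ⟪u, mulL2 hf v⟫_ℝ := by
  rw [MeasureTheory.L2.inner_def, MeasureTheory.L2.inner_def]
  refine integral_congr_ae ?_
  filter_upwards [mulL2_coeFn hf u, mulL2_coeFn hf v] with x h1 h2
  rw [h1, h2]
  simp
  ring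

/-- Multiplication of a test function by a coordinate. -/
def mulCoord (k : Fin n) (φ : testFunctions Ω) : testFunctions Ω :=
  ⟨fun x => x k * (φ : E n → ℝ) x, (contDiff_piLp_apply (p := 2)).mul φ.2.1, φ.2.2.1.mul_left,
    (tsupport_mul_subset_right).trans φ.2.2.2⟩

lemma toL2_mulCoord {k : Fin n} (hf : MemLp (fun x : E n => x k) ⊤ (volume.restrict Ω))
    (φ : testFunctions Ω) : toL2 (mulCoord k φ) = mulL2 hf (toL2 φ) := by
  refine Lp.ext ?_
  filter_upwards [(memLp_test φ).coeFn_toLp, (memLp_test (mulCoord k φ)).coeFn_toLp,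
    mulL2_coeFn hf (toL2 φ)] with x h1 h2 h3
  rw [h3]
  refine h2.trans ?_
  change x k * (φ : E n → ℝ) x = x k * _
  rw [← h1]
  rfl

lemma pd_mulCoord (i k : Fin n) (φ : testFunctions Ω) :
    pd i (mulCoord k φ) = mulCoord k (pd i φ) + (if i = k then (1 : ℝ) else 0) • φ := by
  ext x
  have h1 : HasFDerivAt (fun x : E n => x k) (EuclideanSpace.proj k : E n →L[ℝ] ℝ) x :=
    (EuclideanSpace.proj k : E n →L[ℝ] ℝ).hasFDerivAt
  have h2 := ((φ.2.1.differentiable (by simp)) x).hasFDerivAt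
  change fderiv ℝ (fun x : E n => x k * (φ : E n → ℝ) x) x (EuclideanSpace.single i 1) = _
  rw [HasFDerivAt.fderiv (f := fun x : E n => x k * (φ : E n → ℝ) x) (h1.mul h2)]
  change _ = x k * fderiv ℝ (φ : E n → ℝ) x (EuclideanSpace.single i 1) + _ * (φ : E n → ℝ) x
  rcases eq_or_ne i k with h | h
  · simp [h]
  · simp [h, Ne.symm h]

/-- Multiplication of a jet by a coordinate. -/
def mulJet {k : Fin n} (hf : MemLp (fun x : E n => x k) ⊤ (volume.restrict Ω)) (J : Jet Ω) :
    Jet Ω :=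
  (mulL2 hf J.1, fun i => mulL2 hf (J.2.1 i) + (if i = k then (1 : ℝ) else 0) • J.1,
    fun i j => mulL2 hf (J.2.2 i j) + (if j = k then (1 : ℝ) else 0) • J.2.1 i
      + (if i = k then (1 : ℝ) else 0) • J.2.1 j)

variable {k : Fin n} (hf : MemLp (fun x : E n => x k) ⊤ (volume.restrict Ω))

lemma jet_mulCoord (φ : testFunctions Ω) : jet (mulCoord k φ) = mulJet hf (jet φ) := by
  refine Prod.ext (toL2_mulCoord hf φ) (Prod.ext (funext fun i => ?_)
    (funext fun i => funext fun j => ?_))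
  · change toL2 (pd i (mulCoord k φ)) = mulL2 hf (toL2 (pd i φ)) + _ • toL2 φ
    rw [pd_mulCoord, map_add, map_smul, toL2_mulCoord hf]
  · change toL2 (pd j (pd i (mulCoord k φ)))
      = mulL2 hf (toL2 (pd j (pd i φ))) + _ • toL2 (pd i φ) + _ • toL2 (pd j φ)
    rw [pd_mulCoord, map_add, map_smul, pd_mulCoord, map_add, map_smul, map_add, map_smul,
      toL2_mulCoord hf]

lemma continuous_mulJet : Continuous (mulJet hf) := by
  unfold mulJet
  fun_prop

lemma mulJet_mem {J : Jet Ω} (hJ : J ∈ jetSpace Ω) : mulJet hf J ∈ jetSpace Ω :=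
  jetSpace_induction (isClosed_jetSpace.preimage (continuous_mulJet hf))
    (fun φ => by rw [← jet_mulCoord]; exact jet_mem _) hJ

lemma grad_mulJet (J : Jet Ω) : grad k (mulJet hf J) = mulL2 hf (grad k J) + J.1 := by
  simp [grad_apply, mulJet]

lemma lap_mulJet (J : Jet Ω) :
    lap (mulJet hf J) = mulL2 hf (lap J) + (2 : ℝ) • grad k J := by
  simp only [lap_apply, grad_apply, mulJet, Finset.sum_add_distrib, map_sum, two_smul]
  simp [add_assoc]

/-- Multiplication by x_k is self-adjoint, so only the commutator [Δ, x_k] = 2∂_k survives. -/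
lemma inner_lap_mulJet (J J' : Jet Ω) :
    ⟪lap (mulJet hf J), lap J'⟫_ℝ = ⟪lap J, lap (mulJet hf J')⟫_ℝ
      + 2 * (⟪grad k J, lap J'⟫_ℝ - ⟪lap J, grad k J'⟫_ℝ) := by
  rw [lap_mulJet, lap_mulJet, inner_add_left, inner_add_right, inner_mulL2, inner_smul_left,
    inner_smul_right]
  simp
  ring

/-- The two terms containing x_k cancel; -⟪Δu, u⟫ supplies the full gradient norm. -/
lemma commutator_mulJet {J : Jet Ω} (hJ : J ∈ jetSpace Ω) :
    ⟪grad k J, lap (mulJet hf J)⟫_ℝ - ⟪lap J, grad k (mulJet hf J)⟫_ℝ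
      = 2 * ‖grad k J‖ ^ 2 + ∑ l, ‖grad l J‖ ^ 2 := by
  rw [lap_mulJet, grad_mulJet, inner_add_right, inner_add_right, inner_smul_right,
    inner_lap_self hJ, real_inner_self_eq_norm_sq, ← inner_mulL2, real_inner_comm]
  simp only [grad_apply]
  ring

lemma inner_mulJet_grad {J : Jet Ω} (hJ : J ∈ jetSpace Ω) :
    ⟪(mulJet hf J).1, grad k J⟫_ℝ = - (1 / 2) * ‖J.1‖ ^ 2 := by
  have h := inner_grad_left hJ (mulJet_mem hf hJ) k
  change ⟪grad k J, _⟫_ℝ = -⟪J.1, grad k (mulJet hf J)⟫_ℝ at h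
  rw [grad_mulJet, inner_add_right, real_inner_self_eq_norm_sq, ← inner_mulL2,
    real_inner_comm] at h
  change _ = -(⟪(mulJet hf J).1, _⟫_ℝ + _) at h
  linarith

end Multiplication

/-! ### Rellich compactness by the Fourier transform. -/

open FourierTransform LineDeriv
open scoped SchwartzMap

section Rellich

variable {n : ℕ} {Ω : Set (E n)}

lemma exists_subseq_tendsto_inner {H : Type*} [NormedAddCommGroup H] [InnerProductSpace ℝ H]
    [CompleteSpace H] [TopologicalSpace.SeparableSpace H] {x : ℕ → H} {C : ℝ}
    (hx : ∀ k, ‖x k‖ ≤ C) :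
    ∃ (w : H) (s : ℕ → ℕ), StrictMono s ∧
      ∀ v, Filter.Tendsto (fun k => ⟪x (s k), v⟫_ℝ) Filter.atTop (𝓝 ⟪w, v⟫_ℝ) := by
  obtain ⟨a, -, s, hs, ha⟩ := WeakDual.isSeqCompact_closedBall ℝ H 0 C
    (x := fun k => StrongDual.toWeakDual (InnerProductSpace.toDual ℝ H (x k)))
    (fun k => by simpa using! hx k)
  refine ⟨(InnerProductSpace.toDual ℝ H).symm (WeakDual.toStrongDual a), s, hs, fun v => ?_⟩
  have h := ((WeakDual.eval_continuous v).tendsto a).comp ha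
  simpa using! h

/-- A real test function as a complex Schwartz function. -/
def toSchwartz (φ : testFunctions Ω) : 𝓢(E n, ℂ) :=
  HasCompactSupport.toSchwartzMap (f := fun x => ((φ : E n → ℝ) x : ℂ))
    (φ.2.2.1.comp_left Complex.ofReal_zero) (Complex.ofRealCLM.contDiff.comp φ.2.1)

lemma toSchwartz_apply (φ : testFunctions Ω) (x : E n) :
    toSchwartz φ x = ((φ : E n → ℝ) x : ℂ) := rfl

lemma fourier_toSchwartz_sub (φ ψ : testFunctions Ω) (ξ : E n) :
    𝓕 (toSchwartz (φ - ψ)) ξ = 𝓕 (toSchwartz φ) ξ - 𝓕 (toSchwartz ψ) ξ := by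
  have h : toSchwartz (φ - ψ) = toSchwartz φ - toSchwartz ψ := by
    ext x
    simp [toSchwartz_apply]
  rw [h, sub_eq_add_neg, FourierTransform.fourier_add, FourierTransform.fourier_neg]
  simp [sub_eq_add_neg]

lemma fourier_toSchwartz_pd (i : Fin n) (φ : testFunctions Ω) (ξ : E n) :
    𝓕 (toSchwartz (pd i φ)) ξ = 2 * Real.pi * Complex.I * ξ i * 𝓕 (toSchwartz φ) ξ := by
  have h : toSchwartz (pd i φ) = ∂_{EuclideanSpace.single i (1 : ℝ)} (toSchwartz φ) := by
    ext x
    have h1 := (((φ.2.1.differentiable (by simp)) x).hasFDerivAt)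
    have h2 := (Complex.ofRealCLM.hasFDerivAt (x := (φ : E n → ℝ) x)).comp x h1
    rw [SchwartzMap.lineDerivOp_apply_eq_fderiv]
    have h3 : fderiv ℝ (toSchwartz φ) x = _ := h2.fderiv
    rw [h3]
    rfl
  rw [h, SchwartzMap.fourier_lineDerivOp_eq]
  have h4 : (inner ℝ · (EuclideanSpace.single i (1 : ℝ)) : E n → ℝ).HasTemperateGrowth :=
    ((innerSL ℝ).flip (EuclideanSpace.single i (1 : ℝ))).hasTemperateGrowth
  rw [smul_apply, SchwartzMap.smulLeftCLM_apply_apply h4]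
  simp [EuclideanSpace.inner_single_right]
  ring

lemma integrable_norm_sq (f : 𝓢(E n, ℂ)) : Integrable fun ξ => ‖f ξ‖ ^ 2 :=
  (f.memLp 2).integrable_norm_pow (by simp)

lemma integral_norm_sq_fourier_toSchwartz (φ : testFunctions Ω) :
    ∫ ξ, ‖𝓕 (toSchwartz φ) ξ‖ ^ 2 = ‖toL2 φ‖ ^ 2 := by
  rw [SchwartzMap.integral_norm_sq_fourier, ← real_inner_self_eq_norm_sq, integral_test]
  refine integral_congr_ae (Filter.Eventually.of_forall fun x => ?_)
  simp [toSchwartz_apply, sq]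

/-- Plancherel: for |ξ| > R the gradient has Fourier density (2π|ξ|)² |φ̂|² ≥ R² |φ̂|², which bounds
the high frequencies uniformly. -/
lemma norm_sq_fourier_le (φ : testFunctions Ω) {R : ℝ} (hR : 0 < R) :
    ‖toL2 φ‖ ^ 2 ≤ (∫ ξ in Metric.closedBall 0 R, ‖𝓕 (toSchwartz φ) ξ‖ ^ 2)
      + (R ^ 2)⁻¹ * ∑ i, ‖toL2 (pd i φ)‖ ^ 2 := by
  have hint := fun ψ : testFunctions Ω => integrable_norm_sq (𝓕 (toSchwartz ψ))
  simp only [← integral_norm_sq_fourier_toSchwartz]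
  rw [← integral_indicator Metric.isClosed_closedBall.measurableSet, ← integral_finsetSum _
    (fun i _ => hint _), ← integral_const_mul, ← integral_add]
  · refine integral_mono (hint φ) ?_ fun ξ => ?_
    · exact ((hint φ).indicator Metric.isClosed_closedBall.measurableSet).add
        ((integrable_finsetSum _ fun i _ => hint _).const_mul _)
    · by_cases hξ : ξ ∈ Metric.closedBall (0 : E n) R
      · simp only [Set.indicator_of_mem hξ]
        have : 0 ≤ (R ^ 2)⁻¹ * ∑ i, ‖𝓕 (toSchwartz (pd i φ)) ξ‖ ^ 2 := by positivity
        linarith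
      · simp only [Set.indicator_of_notMem hξ, zero_add, fourier_toSchwartz_pd, norm_mul, mul_pow]
        rw [← Finset.sum_mul, ← Finset.mul_sum]
        have h1 : ∑ i, ‖((ξ i : ℝ) : ℂ)‖ ^ 2 = ‖ξ‖ ^ 2 := by
          simp [EuclideanSpace.norm_sq_eq]
        have h2 : R < ‖ξ‖ := by simpa using hξ
        have h3 : (1 : ℝ) ≤ 2 * Real.pi := by linarith [Real.pi_gt_three]
        rw [h1]
        simp only [Complex.norm_real, Complex.norm_I, Complex.norm_ofNat, Real.norm_eq_abs,
          abs_of_pos Real.pi_pos, one_pow, mul_one]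
        rw [← mul_assoc, ← mul_assoc]
        refine le_mul_of_one_le_left (by positivity) ?_
        rw [mul_assoc, inv_mul_eq_div, one_le_div (by positivity)]
        nlinarith [mul_le_mul h3 h2.le hR.le (by positivity)]
  · exact (hint φ).indicator Metric.isClosed_closedBall.measurableSet
  · exact (integrable_finsetSum _ fun i _ => hint _).const_mul _

lemma memLp_of_norm_le_one (hΩ : Bornology.IsBounded Ω) {f : E n → ℝ} (hf : Continuous f)
    (h1 : ∀ x, ‖f x‖ ≤ 1) : MemLp f 2 (volume.restrict Ω) :=
  have : IsFiniteMeasure (volume.restrict Ω) := ⟨by simpa using hΩ.measure_lt_top⟩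
  MemLp.of_bound hf.aestronglyMeasurable 1 (Filter.Eventually.of_forall h1)

lemma inner_toL2_toLp {f : E n → ℝ} (hf : MemLp f 2 (volume.restrict Ω))
    (φ : testFunctions Ω) : ⟪toL2 φ, hf.toLp⟫_ℝ = ∫ x, f x * (φ : E n → ℝ) x := by
  rw [inner_toL2, ← setIntegral_eq_integral_of_forall_compl_eq_zero (s := Ω) (μ := volume)
    (f := fun x => f x * (φ : E n → ℝ) x)]
  · refine integral_congr_ae ?_
    filter_upwards [hf.coeFn_toLp] with x hx
    rw [hx]
  · intro x hx
    rw [image_eq_zero_of_notMem_tsupport fun h => hx (φ.2.2.2 h), mul_zero]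

/-- On a bounded Ω the functions cos and sin of 2π⟨x, ξ⟩ lie in L²(Ω) with norms bounded
independently of ξ. Weak convergence in L²(Ω) therefore gives pointwise convergence of Fourier
transforms, with a uniform bound. -/
lemma exists_fourier_toSchwartz_eq_inner (hΩ : Bornology.IsBounded Ω) :
    ∃ M : ℝ, ∀ ξ : E n, ∃ c s : L2 Ω, ‖c‖ ≤ M ∧ ‖s‖ ≤ M ∧ ∀ φ : testFunctions Ω,
      𝓕 (toSchwartz φ) ξ = (⟪toL2 φ, c⟫_ℝ : ℂ) + (⟪toL2 φ, s⟫_ℝ : ℂ) * Complex.I := by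
  have : IsFiniteMeasure (volume.restrict Ω) := ⟨by simpa using hΩ.measure_lt_top⟩
  refine ⟨measureUnivNNReal (volume.restrict Ω) ^ (2 : ENNReal).toReal⁻¹ * 1, fun ξ => ?_⟩
  have hc := memLp_of_norm_le_one hΩ (f := fun x => Real.cos (-2 * Real.pi * ⟪x, ξ⟫_ℝ))
    (by fun_prop) fun x => Real.abs_cos_le_one _
  have hs := memLp_of_norm_le_one hΩ (f := fun x => Real.sin (-2 * Real.pi * ⟪x, ξ⟫_ℝ))
    (by fun_prop) fun x => Real.abs_sin_le_one _
  refine ⟨hc.toLp, hs.toLp, Lp.norm_le_of_ae_bound zero_le_one ?_,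
    Lp.norm_le_of_ae_bound zero_le_one ?_, fun φ => ?_⟩
  · filter_upwards [hc.coeFn_toLp] with x hx
    rw [hx]
    exact Real.abs_cos_le_one _
  · filter_upwards [hs.coeFn_toLp] with x hx
    rw [hx]
    exact Real.abs_sin_le_one _
  · have hint : ∀ f : E n → ℝ, Continuous f →
        Integrable (fun x => ((f x * (φ : E n → ℝ) x : ℝ) : ℂ)) := fun f hf =>
      ((hf.mul φ.2.1.continuous).integrable_of_hasCompactSupport φ.2.2.1.mul_left).ofReal
    rw [inner_toL2_toLp, inner_toL2_toLp, ← integral_complex_ofReal, ← integral_complex_ofReal,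
      ← integral_mul_const, ← integral_add (hint _ (by fun_prop))
      ((hint _ (by fun_prop)).mul_const _), SchwartzMap.fourier_coe, Real.fourier_eq']
    refine integral_congr_ae (Filter.Eventually.of_forall fun x => ?_)
    simp only [toSchwartz_apply, smul_eq_mul, Complex.exp_mul_I]
    push_cast
    ring

lemma exists_subseq_cauchySeq_toL2 (hΩ : Bornology.IsBounded Ω) {φ : ℕ → testFunctions Ω} {C : ℝ}
    (h0 : ∀ k, ‖toL2 (φ k)‖ ≤ C) (h1 : ∀ k i, ‖toL2 (pd i (φ k))‖ ≤ C) :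
    ∃ s : ℕ → ℕ, StrictMono s ∧ CauchySeq fun k => toL2 (φ (s k)) := by
  have : Fact ((2 : ENNReal) ≠ ⊤) := ⟨by simp⟩
  obtain ⟨w, s, hs, hw⟩ := exists_subseq_tendsto_inner h0
  refine ⟨s, hs, cauchySeq_iff_tendsto_dist_atTop_0.mpr ?_⟩
  obtain ⟨M, hM⟩ := exists_fourier_toSchwartz_eq_inner hΩ
  have hC : 0 ≤ C := (norm_nonneg _).trans (h0 0)
  have hbound : ∀ k ξ, ‖𝓕 (toSchwartz (φ k)) ξ‖ ≤ C * M + C * M := by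
    intro k ξ
    obtain ⟨c, d, hc, hd, hF⟩ := hM ξ
    rw [hF]
    refine (norm_add_le _ _).trans (add_le_add ?_ ?_)
    · rw [Complex.norm_real]
      exact (norm_inner_le_norm _ _).trans (mul_le_mul (h0 k) hc (norm_nonneg _) hC)
    · rw [norm_mul, Complex.norm_I, mul_one, Complex.norm_real]
      exact (norm_inner_le_norm _ _).trans (mul_le_mul (h0 k) hd (norm_nonneg _) hC)
  have hptw : ∀ ξ, Filter.Tendsto
      (fun p : ℕ × ℕ => ‖𝓕 (toSchwartz (φ (s p.1) - φ (s p.2))) ξ‖ ^ 2) Filter.atTop (𝓝 0) := by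
    intro ξ
    obtain ⟨c, d, -, -, hF⟩ := hM ξ
    have hlim : Filter.Tendsto (fun k => 𝓕 (toSchwartz (φ (s k))) ξ) Filter.atTop
        (𝓝 ((⟪w, c⟫_ℝ : ℂ) + (⟪w, d⟫_ℝ : ℂ) * Complex.I)) := by
      simp only [hF]
      exact ((Complex.continuous_ofReal.tendsto _).comp (hw c)).add
        (((Complex.continuous_ofReal.tendsto _).comp (hw d)).mul_const _)
    have h := cauchySeq_iff_tendsto_dist_atTop_0.mp hlim.cauchySeq
    simp only [fourier_toSchwartz_sub]
    simpa [dist_eq_norm] using h.pow 2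
  -- Low frequencies: dominated convergence with a constant majorant on a ball.
  have hball : ∀ R : ℝ, Filter.Tendsto (fun p : ℕ × ℕ => ∫ ξ in Metric.closedBall 0 R,
      ‖𝓕 (toSchwartz (φ (s p.1) - φ (s p.2))) ξ‖ ^ 2) Filter.atTop (𝓝 0) := by
    intro R
    rw [← integral_zero (E n) ℝ (μ := volume.restrict (Metric.closedBall 0 R))]
    refine tendsto_integral_filter_of_dominated_convergence
      (fun _ => (2 * (C * M + C * M)) ^ 2) ?_ ?_ ?_ (Filter.Eventually.of_forall hptw)
    · exact Filter.Eventually.of_forall fun p => (integrable_norm_sq _).1.restrict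
    · refine Filter.Eventually.of_forall fun p => Filter.Eventually.of_forall fun ξ => ?_
      rw [norm_pow, norm_norm, fourier_toSchwartz_sub]
      refine pow_le_pow_left₀ (norm_nonneg _) ((norm_sub_le _ _).trans ?_) 2
      linarith [hbound (s p.1) ξ, hbound (s p.2) ξ]
    · exact integrableOn_const measure_closedBall_lt_top.ne
  have hsq : Filter.Tendsto (fun p : ℕ × ℕ => ‖toL2 (φ (s p.1) - φ (s p.2))‖ ^ 2) Filter.atTop
      (𝓝 0) := by
    rw [Metric.tendsto_nhds]
    intro ε hε
    -- T bounds the squared gradient norm of a difference; R is then chosen so that the high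
    -- frequencies contribute less than ε/2.
    set T : ℝ := n * (2 * C) ^ 2 with hT
    have hT0 : 0 ≤ T := by positivity
    obtain ⟨R, hR, hRε⟩ : ∃ R : ℝ, 0 < R ∧ (R ^ 2)⁻¹ * T < ε / 2 := by
      have h := ((Filter.tendsto_pow_atTop (α := ℝ) two_ne_zero).inv_tendsto_atTop.mul_const T)
      rw [zero_mul] at h
      obtain ⟨R, h2, h3⟩ := ((Filter.eventually_gt_atTop 0).and
        (h.eventually_lt_const (half_pos hε))).exists
      exact ⟨R, h2, h3⟩
    filter_upwards [(hball R).eventually_lt_const (half_pos hε)] with p hp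
    rw [Real.dist_eq, sub_zero, abs_of_nonneg (by positivity)]
    refine (norm_sq_fourier_le _ hR).trans_lt ?_
    have h2 : ∑ i, ‖toL2 (pd i (φ (s p.1) - φ (s p.2)))‖ ^ 2 ≤ T := by
      refine (Finset.sum_le_sum fun i _ => pow_le_pow_left₀ (norm_nonneg _)
        (?_ : _ ≤ 2 * C) 2).trans (le_of_eq (by simp [hT]))
      rw [map_sub, map_sub]
      exact (norm_sub_le _ _).trans (by linarith [h1 (s p.1) i, h1 (s p.2) i])
    have h3 := mul_le_mul_of_nonneg_left h2 (inv_nonneg.mpr (sq_nonneg R))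
    linarith
  have h := hsq.sqrt
  simpa [dist_eq_norm, ← map_sub, Real.sqrt_sq] using h

/-- Rellich's theorem for `H²₀(Ω)`. -/
theorem exists_subseq_tendsto_of_mem_jetSpace (hΩ : Bornology.IsBounded Ω) {J : ℕ → Jet Ω}
    (hJ : ∀ k, J k ∈ jetSpace Ω) {C : ℝ} (hC : ∀ k, ‖J k‖ ≤ C) :
    ∃ (w : L2 Ω) (s : ℕ → ℕ), StrictMono s ∧
      Filter.Tendsto (fun k => (J (s k)).1) Filter.atTop (𝓝 w) := by
  -- Test functions at distance tending to 0 have the same L² limits, so compactness need only be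
  -- known for them.
  have happ : ∀ k, ∃ φ : testFunctions Ω, ‖J k - jet φ‖ < 1 / ((k : ℝ) + 1) := by
    intro k
    obtain ⟨_, ⟨φ, rfl⟩, hφ⟩ := Metric.mem_closure_iff.mp (hJ k) (1 / ((k : ℝ) + 1))
      (by positivity)
    exact ⟨φ, by rwa [← dist_eq_norm]⟩
  choose φ hφ using happ
  have hφC : ∀ k, ‖jet (φ k)‖ ≤ C + 1 := by
    intro k
    have h1 : 1 / ((k : ℝ) + 1) ≤ 1 := by
      rw [div_le_one (by positivity)]
      linarith [(Nat.cast_nonneg k : (0 : ℝ) ≤ k)]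
    have h2 := norm_sub_norm_le (jet (φ k)) (J k)
    rw [norm_sub_rev] at h2
    linarith [hC k, hφ k]
  obtain ⟨s, hs, hc⟩ := exists_subseq_cauchySeq_toL2 hΩ (φ := φ) (C := C + 1)
    (fun k => (norm_fst_le (jet (φ k))).trans (hφC k))
    (fun k i => (norm_le_pi_norm (jet (φ k)).2.1 i).trans
      ((norm_fst_le (jet (φ k)).2).trans ((norm_snd_le (jet (φ k))).trans (hφC k))))
  obtain ⟨w, hw⟩ := cauchySeq_tendsto_of_complete hc
  refine ⟨w, s, hs, ?_⟩
  have h0 : Filter.Tendsto (fun k => (J k).1 - toL2 (φ k)) Filter.atTop (𝓝 0) :=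
    squeeze_zero_norm (fun k => (norm_fst_le (J k - jet (φ k))).trans (hφ k).le)
      tendsto_one_div_add_atTop_nhds_zero_nat
  simpa using (h0.comp hs.tendsto_atTop).add hw

end Rellich

/-! ### Weak formulation and the variational principle. -/

section Minimizer

variable {n : ℕ} {Ω : Set (E n)}

lemma mem_eigenspace_iff {γ : ℝ} {w : L2 Ω} :
    w ∈ eigenspace Ω γ ↔ ∃ J ∈ jetSpace Ω, J.1 = w ∧
      ∀ J' ∈ jetSpace Ω, ⟪lap J, lap J'⟫_ℝ = γ * ⟪J.1, J'.1⟫_ℝ := by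
  have key : ∀ J ∈ jetSpace Ω, ∀ φ : testFunctions Ω,
      ∫ x in Ω, J.1 x * Δ (Δ (φ : E n → ℝ)) x = ⟪lap J, lap (jet φ)⟫_ℝ := by
    intro J hJ φ
    have h1 : lap (jet φ) = toL2 (∑ i, pd i (pd i φ)) := by
      rw [map_sum]
      rfl
    rw [h1, laplacian_test, laplacian_test, ← inner_toL2]
    generalize ∑ i, pd i (pd i φ) = ψ
    rw [map_sum, sum_inner, lap_apply, sum_inner]
    refine Finset.sum_congr rfl fun i _ => ?_
    have h2 := inner_grad_left (jet_mem (pd i ψ)) hJ i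
    have h3 := inner_grad_left (jet_mem ψ) hJ i
    have h4 := inner_grad_grad hJ (jet_mem ψ) i i
    rw [real_inner_comm] at h4
    exact h2.trans (neg_eq_iff_eq_neg.mpr h4)
  constructor
  · rintro ⟨⟨J, hJ, rfl⟩, hw⟩
    refine ⟨J, hJ, rfl, fun J' hJ' => ?_⟩
    refine jetSpace_induction (p := fun J' => ⟪lap J, lap J'⟫_ℝ = γ * ⟪J.1, J'.1⟫_ℝ)
      (isClosed_eq (by fun_prop) (by fun_prop)) (fun φ => ?_) hJ'
    rw [← key J hJ φ, real_inner_comm]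
    refine (hw φ φ.2).trans ?_
    rw [← inner_toL2]
    rfl
  · rintro ⟨J, hJ, rfl, hw⟩
    refine ⟨⟨J, hJ, rfl⟩, fun φ hφ => ?_⟩
    rw [key J hJ ⟨φ, hφ⟩, hw _ (jet_mem _), real_inner_comm, ← inner_toL2 _ ⟨φ, hφ⟩]
    rfl

/-- Direct method: a minimizing sequence converges in L² along a subsequence by Rellich, and the
parallelogram law upgrades this to convergence in H². -/
lemma exists_minimizer (hΩ : Bornology.IsBounded Ω) {V : Submodule ℝ (Jet Ω)}
    (hV : V ≤ jetSpace Ω) (hVc : IsClosed (V : Set (Jet Ω))) {J₀ : Jet Ω} (hJ₀ : J₀ ∈ V)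
    (hne : J₀.1 ≠ 0) :
    ∃ J ∈ V, ‖J.1‖ = 1 ∧ ∀ J' ∈ V, ‖lap J‖ ^ 2 * ‖J'.1‖ ^ 2 ≤ ‖lap J'‖ ^ 2 := by
  set S : Set ℝ := {q | ∃ J ∈ V, ‖J.1‖ = 1 ∧ ‖lap J‖ ^ 2 = q} with hS
  have hnormalize : ∀ J ∈ V, J.1 ≠ 0 → ‖lap J‖ ^ 2 / ‖J.1‖ ^ 2 ∈ S := by
    intro J hJ h0
    refine ⟨‖J.1‖⁻¹ • J, V.smul_mem _ hJ, ?_, ?_⟩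
    · rw [Prod.smul_fst, norm_smul, norm_inv, norm_norm, inv_mul_cancel₀ (norm_ne_zero_iff.mpr h0)]
    · rw [map_smul, norm_smul, norm_inv, norm_norm, mul_pow, inv_pow, inv_mul_eq_div]
  have hSb : BddBelow S := ⟨0, by rintro _ ⟨J, -, -, rfl⟩; positivity⟩
  have hlow : ∀ J ∈ V, sInf S * ‖J.1‖ ^ 2 ≤ ‖lap J‖ ^ 2 := by
    intro J hJ
    by_cases h0 : J.1 = 0
    · simp [h0]
    · have h1 : 0 < ‖J.1‖ ^ 2 := by positivity
      exact (le_div_iff₀ h1).mp (csInf_le hSb (hnormalize J hJ h0))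
  obtain ⟨q, hqa, hq, hqS⟩ := exists_seq_tendsto_sInf ⟨_, hnormalize J₀ hJ₀ hne⟩ hSb
  choose J hJV hJ1 hJq using hqS
  have hJC : ∀ k, ‖J k‖ ≤ 1 + √(q 0) := by
    intro k
    refine (norm_le_of_mem_jetSpace (hV (hJV k))).trans ?_
    rw [hJ1]
    gcongr
    exact Real.le_sqrt_of_sq_le ((hJq k).trans_le (hqa (Nat.zero_le k)))
  obtain ⟨w, s, hs, hw⟩ := exists_subseq_tendsto_of_mem_jetSpace hΩ (fun k => hV (hJV k)) hJC
  have hq' := hq.comp hs.tendsto_atTop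
  have hw2 : Filter.Tendsto (fun p : ℕ × ℕ => ‖(J (s p.1)).1 - (J (s p.2)).1‖) Filter.atTop
      (𝓝 0) := by
    simpa only [dist_eq_norm] using cauchySeq_iff_tendsto_dist_atTop_0.mp hw.cauchySeq
  have hlap : Filter.Tendsto (fun p : ℕ × ℕ => ‖lap (J (s p.1) - J (s p.2))‖) Filter.atTop
      (𝓝 0) := by
    have hfst : Filter.Tendsto (fun p : ℕ × ℕ => q (s p.1)) Filter.atTop (𝓝 (sInf S)) := by
      rw [← Filter.prod_atTop_atTop_eq]
      exact hq'.comp Filter.tendsto_fst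
    have hsnd : Filter.Tendsto (fun p : ℕ × ℕ => q (s p.2)) Filter.atTop (𝓝 (sInf S)) := by
      rw [← Filter.prod_atTop_atTop_eq]
      exact hq'.comp Filter.tendsto_snd
    have h0 : Filter.Tendsto (fun p : ℕ × ℕ => √(2 * (q (s p.1) - sInf S)
        + 2 * (q (s p.2) - sInf S) + sInf S * ‖(J (s p.1)).1 - (J (s p.2)).1‖ ^ 2))
        Filter.atTop (𝓝 0) := by
      have h1 := ((((hfst.sub_const (sInf S)).const_mul 2).add
        ((hsnd.sub_const (sInf S)).const_mul 2)).add ((hw2.pow 2).const_mul (sInf S))).sqrt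
      simpa using h1
    refine squeeze_zero (fun _ => norm_nonneg _) (fun p => Real.le_sqrt_of_sq_le ?_) h0
    -- The sum of two members has energy at least sInf S times its squared L² norm, which bounds the
    -- energy of their difference from above.
    have h1 := hlow _ (V.add_mem (hJV (s p.1)) (hJV (s p.2)))
    have h2 := parallelogram_law_with_norm ℝ (lap (J (s p.1))) (lap (J (s p.2)))
    have h3 := parallelogram_law_with_norm ℝ (J (s p.1)).1 (J (s p.2)).1
    simp only [hJq, hJ1] at h2 h3
    rw [map_add, Prod.fst_add] at h1
    rw [map_sub]
    have h4 : ‖(J (s p.1)).1 + (J (s p.2)).1‖ ^ 2 = 4 - ‖(J (s p.1)).1 - (J (s p.2)).1‖ ^ 2 := by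
      linarith
    rw [h4] at h1
    linarith
  have hcauchy : CauchySeq fun k => J (s k) := by
    refine cauchySeq_iff_tendsto_dist_atTop_0.mpr
      (squeeze_zero (fun _ => dist_nonneg) (fun p => ?_) (by simpa only [add_zero] using hw2.add hlap))
    rw [dist_eq_norm, ← Prod.fst_sub]
    exact norm_le_of_mem_jetSpace (hV (V.sub_mem (hJV (s p.1)) (hJV (s p.2))))
  obtain ⟨J', hJ'⟩ := cauchySeq_tendsto_of_complete hcauchy
  have h1 : ‖J'.1‖ = 1 := by
    refine tendsto_nhds_unique (((continuous_fst.norm).tendsto J').comp hJ') ?_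
    simp [Function.comp_def, hJ1]
  have h2 : ‖lap J'‖ ^ 2 = sInf S := by
    refine tendsto_nhds_unique (((continuous_lap.norm.pow 2).tendsto J').comp hJ') ?_
    simpa only [Function.comp_def, Pi.pow_apply, hJq] using hq'
  exact ⟨J', hVc.mem_of_tendsto hJ' (Filter.Eventually.of_forall fun k => hJV _), h1,
    fun K hK => h2 ▸ hlow K hK⟩

/-- Euler–Lagrange equation: the excess energy along J + tJ' is a nonnegative quadratic in t without
constant term, so its linear coefficient vanishes. -/
lemma inner_lap_eq_of_minimizer {V : Submodule ℝ (Jet Ω)} {J : Jet Ω} (hJ : J ∈ V)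
    (h1 : ‖J.1‖ = 1) (hmin : ∀ J' ∈ V, ‖lap J‖ ^ 2 * ‖J'.1‖ ^ 2 ≤ ‖lap J'‖ ^ 2) {J' : Jet Ω}
    (hJ' : J' ∈ V) : ⟪lap J, lap J'⟫_ℝ = ‖lap J‖ ^ 2 * ⟪J.1, J'.1⟫_ℝ := by
  set b := ⟪lap J, lap J'⟫_ℝ - ‖lap J‖ ^ 2 * ⟪J.1, J'.1⟫_ℝ with hb
  set c := ‖lap J'‖ ^ 2 - ‖lap J‖ ^ 2 * ‖J'.1‖ ^ 2 with hc
  have hc0 : 0 ≤ c := sub_nonneg.mpr (hmin J' hJ')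
  have h : ∀ t : ℝ, 0 ≤ c * (t * t) + 2 * b * t + 0 := by
    intro t
    have h2 := hmin _ (V.add_mem hJ (V.smul_mem t hJ'))
    rw [map_add, map_smul, Prod.fst_add, Prod.smul_fst, norm_add_sq_real, norm_add_sq_real,
      inner_smul_right, inner_smul_right, norm_smul, norm_smul, mul_pow, mul_pow, h1,
      Real.norm_eq_abs, sq_abs] at h2
    rw [hb, hc]
    linarith
  have h3 := discrim_le_zero h
  have h4 : b = 0 := by
    rw [discrim] at h3
    nlinarith [sq_nonneg b]
  exact sub_eq_zero.mp h4

/-- The variational principle: if every eigenfunction with eigenvalue below `B` that is orthogonal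
to the eigenfunctions `u i` vanishes, then `B` bounds the Rayleigh quotient from below on the
orthogonal complement of the `u i`. -/
theorem mul_norm_sq_le_norm_lap_sq (hΩ : Bornology.IsBounded Ω) {s : Type*} [Fintype s]
    {u : s → jetSpace Ω} {μ : s → ℝ} {B : ℝ} (hu : Orthonormal ℝ fun i => (u i).1.1)
    (heig : ∀ i, ∀ J : jetSpace Ω, ⟪lap (u i).1, lap J.1⟫_ℝ = μ i * ⟪(u i).1.1, J.1.1⟫_ℝ)
    (hB : ∀ γ < B, ∀ w ∈ eigenspace Ω γ, (∀ i, ⟪(u i).1.1, w⟫_ℝ = 0) → w = 0)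
    {J : Jet Ω} (hJ : J ∈ jetSpace Ω) (horth : ∀ i, ⟪(u i).1.1, J.1⟫_ℝ = 0) :
    B * ‖J.1‖ ^ 2 ≤ ‖lap J‖ ^ 2 := by
  classical
  by_contra! hlt
  let V : Submodule ℝ (Jet Ω) := jetSpace Ω ⊓ ⨅ i,
    (innerSL ℝ (u i).1.1 ∘L ContinuousLinearMap.fst ℝ (L2 Ω) _ : Jet Ω →L[ℝ] ℝ).ker
  have hmem : ∀ K, K ∈ V ↔ K ∈ jetSpace Ω ∧ ∀ i, ⟪(u i).1.1, K.1⟫_ℝ = 0 := by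
    intro K
    simp [V]
  have hVc : IsClosed (V : Set (Jet Ω)) := by
    have : (V : Set (Jet Ω)) = (jetSpace Ω : Set (Jet Ω)) ∩ ⋂ i, {K | ⟪(u i).1.1, K.1⟫_ℝ = 0} := by
      ext K
      simp only [SetLike.mem_coe, hmem, Set.mem_inter_iff, Set.mem_iInter, Set.mem_ofPred_eq]
    rw [this]
    exact isClosed_jetSpace.inter
      (isClosed_iInter fun i => isClosed_eq (by fun_prop) continuous_const)
  have hne : J.1 ≠ 0 := by
    intro h0
    rw [h0] at hlt
    simp at hlt
    exact absurd hlt (not_lt.mpr (sq_nonneg _))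
  obtain ⟨K, hK, hK1, hmin⟩ := exists_minimizer hΩ inf_le_left hVc ((hmem J).mpr ⟨hJ, horth⟩) hne
  have hKB : ‖lap K‖ ^ 2 < B := by
    have h0 : 0 < ‖J.1‖ ^ 2 := by positivity
    exact lt_of_mul_lt_mul_right ((hmin J ((hmem J).mpr ⟨hJ, horth⟩)).trans_lt hlt) h0.le
  have hKe : K.1 ∈ eigenspace Ω (‖lap K‖ ^ 2) := by
    refine mem_eigenspace_iff.mpr ⟨K, ((hmem K).mp hK).1, rfl, fun J' hJ' => ?_⟩
    have hK0 := ((hmem K).mp hK).2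
    have hlap0 : ∀ i, ⟪lap K, lap (u i).1⟫_ℝ = 0 := fun i => by
      rw [real_inner_comm, heig i ⟨K, ((hmem K).mp hK).1⟩, hK0, mul_zero]
    -- The Euler–Lagrange equation is available only against V. The removed u i components are
    -- invisible to both sides, since K is orthogonal to the u i in L² and in energy.
    have hJV : J' - ∑ i, ⟪(u i).1.1, J'.1⟫_ℝ • (u i).1 ∈ V := by
      refine (hmem _).mpr ⟨Submodule.sub_mem _ hJ' (Submodule.sum_mem _ fun i _ =>
        Submodule.smul_mem _ _ (u i).2), fun i => ?_⟩
      simp only [Prod.fst_sub, Prod.fst_sum, Prod.smul_fst, inner_sub_right, inner_sum,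
        inner_smul_right, orthonormal_iff_ite.mp hu]
      simp
    have h := inner_lap_eq_of_minimizer hK hK1 hmin hJV
    simpa [Prod.fst_sum, inner_sub_right, inner_sum, inner_smul_right, hlap0,
      fun i => (real_inner_comm _ _).trans (hK0 i)] using h
  have := hB _ hKB _ hKe ((hmem K).mp hK).2
  rw [this, norm_zero] at hK1
  exact zero_ne_one hK1

end Minimizer

/-! ### From the eigenvalue list to orthonormal eigenfunctions. -/

section Eigenspaces

variable {n : ℕ} {Ω : Set (E n)}

lemma inner_eq_zero_of_mem_eigenspace {γ γ' : ℝ} (h : γ ≠ γ') {w w' : L2 Ω}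
    (hw : w ∈ eigenspace Ω γ) (hw' : w' ∈ eigenspace Ω γ') : ⟪w, w'⟫_ℝ = 0 := by
  obtain ⟨J, hJ, rfl, h1⟩ := mem_eigenspace_iff.mp hw
  obtain ⟨J', hJ', rfl, h2⟩ := mem_eigenspace_iff.mp hw'
  have h3 := h1 J' hJ'
  rw [real_inner_comm, h2 J hJ, real_inner_comm, ← sub_eq_zero, ← sub_mul] at h3
  exact (mul_eq_zero.mp h3).resolve_left (sub_ne_zero.mpr h.symm)

lemma nonneg_of_mem_eigenspace {γ : ℝ} {w : L2 Ω} (hw : w ∈ eigenspace Ω γ) (h0 : w ≠ 0) :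
    0 ≤ γ := by
  obtain ⟨J, hJ, rfl, h1⟩ := mem_eigenspace_iff.mp hw
  have h2 := h1 J hJ
  rw [real_inner_self_eq_norm_sq, real_inner_self_eq_norm_sq] at h2
  have h3 : 0 < ‖J.1‖ ^ 2 := by positivity
  exact nonneg_of_mul_nonneg_left (h2 ▸ sq_nonneg _) h3

variable {Γ : ℕ+ → ℝ}

lemma IsEigenvalueSequence.nonneg (hΓ : IsEigenvalueSequence Ω Γ) (i : ℕ+) : 0 ≤ Γ i := by
  have h : Module.rank ℝ (eigenspace Ω (Γ i)) ≠ 0 := by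
    rw [hΓ.multiplicity, Cardinal.mk_ne_zero_iff]
    exact ⟨⟨i, rfl⟩⟩
  have : Nontrivial (eigenspace Ω (Γ i)) := by
    by_contra hn
    rw [not_nontrivial_iff_subsingleton] at hn
    exact h (rank_subsingleton' _ _)
  obtain ⟨w, hw⟩ := exists_ne (0 : eigenspace Ω (Γ i))
  exact nonneg_of_mem_eigenspace w.2 (by simpa using hw)

lemma IsEigenvalueSequence.exists_orthonormal (hΓ : IsEigenvalueSequence Ω Γ) (γ : ℝ)
    [Finite {i // Γ i = γ}] :
    ∃ v : {i // Γ i = γ} → eigenspace Ω γ, Orthonormal ℝ v ∧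
      Submodule.span ℝ (Set.range v) = ⊤ := by
  have hlt : Module.rank ℝ (eigenspace Ω γ) < Cardinal.aleph0 := by
    rw [hΓ.multiplicity]
    exact Cardinal.mk_lt_aleph0
  have hfin : FiniteDimensional ℝ (eigenspace Ω γ) := Module.rank_lt_aleph0_iff.mp hlt
  have hcard : Module.finrank ℝ (eigenspace Ω γ) = Nat.card {i // Γ i = γ} := by
    rw [Module.finrank, hΓ.multiplicity]
    rfl
  have := Fintype.ofFinite {i // Γ i = γ}
  let b := (stdOrthonormalBasis ℝ (eigenspace Ω γ)).reindex
    ((finCongr hcard).trans (Finite.equivFin _).symm)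
  refine ⟨b, b.orthonormal, ?_⟩
  rw [← b.coe_toBasis]
  exact b.toBasis.span_eq

/-- If `Γ m < Γ (m + 1)`, there are orthonormal eigenfunctions for `Γ 1, …, Γ m`, and an
eigenfunction with eigenvalue below `Γ (m + 1)` orthogonal to all of them vanishes. -/
lemma IsEigenvalueSequence.exists_eigenfunctions (hΓ : IsEigenvalueSequence Ω Γ) {m : ℕ+}
    (hm : Γ m < Γ (m + 1)) :
    ∃ w : ↥(Finset.Icc 1 m) → L2 Ω, Orthonormal ℝ w ∧ (∀ i : ↥(Finset.Icc 1 m), w i ∈ eigenspace Ω (Γ i)) ∧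
      ∀ γ < Γ (m + 1), ∀ x ∈ eigenspace Ω γ, (∀ i, ⟪w i, x⟫_ℝ = 0) → x = 0 := by
  -- The strict gap places every occurrence of such a γ among the first m positions, which also
  -- makes its multiplicity finite.
  have hmem : ∀ γ < Γ (m + 1), ∀ i, Γ i = γ → i ∈ Finset.Icc 1 m := by
    rintro γ hγ i rfl
    refine Finset.mem_Icc.mpr ⟨one_le, ?_⟩
    by_contra! hi
    exact hγ.not_ge (hΓ.monotone (PNat.add_one_le_iff.mpr hi))
  have hfin : ∀ γ < Γ (m + 1), Finite {i // Γ i = γ} := fun γ hγ =>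
    Finite.of_injective (fun i : {i // Γ i = γ} => (⟨i.1, hmem γ hγ i i.2⟩ : Finset.Icc 1 m))
      fun i j hij => Subtype.ext (by simpa using hij)
  have hex : ∀ γ : Set.Iio (Γ (m + 1)), ∃ v : {i // Γ i = γ.1} → eigenspace Ω γ.1,
      Orthonormal ℝ v ∧ Submodule.span ℝ (Set.range v) = ⊤ := fun γ => by
    have := hfin γ.1 γ.2
    exact hΓ.exists_orthonormal γ.1
  choose v hv hspan using hex
  have hlt : ∀ i : ↥(Finset.Icc 1 m), Γ i < Γ (m + 1) := fun i =>
    (hΓ.monotone (Finset.mem_Icc.mp i.2).2).trans_lt hm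
  have hcongr : ∀ (i : ↥(Finset.Icc 1 m)) (γ : ℝ) (hγ : γ < Γ (m + 1)) (h : Γ i = γ),
      ((v ⟨Γ i, hlt i⟩ ⟨i, rfl⟩ : eigenspace Ω (Γ i)) : L2 Ω) = v ⟨γ, hγ⟩ ⟨i, h⟩ := by
    intro i γ hγ h
    subst h
    rfl
  refine ⟨fun i : ↥(Finset.Icc 1 m) => v ⟨Γ i, hlt i⟩ ⟨i, rfl⟩, ⟨fun i => (hv _).1 _, fun i j hij => ?_⟩,
    fun i => (v ⟨Γ i, hlt i⟩ ⟨i, rfl⟩).2, fun γ hγ x hx h0 => ?_⟩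
  · by_cases h : Γ j = Γ i
    · change ⟪_, ((v ⟨Γ j, hlt j⟩ ⟨j, rfl⟩ : eigenspace Ω (Γ j)) : L2 Ω)⟫_ℝ = 0
      rw [hcongr j (Γ i) (hlt i) h]
      exact (hv ⟨Γ i, hlt i⟩).2 fun h' => hij (Subtype.ext (Subtype.mk.inj h'))
    · exact inner_eq_zero_of_mem_eigenspace (Ne.symm h) (v ⟨Γ i, hlt i⟩ ⟨i, rfl⟩).2
        (v ⟨Γ j, hlt j⟩ ⟨j, rfl⟩).2
  -- The basis of the γ-eigenspace consists of some of the w i, so x is orthogonal to itself. If γ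
  -- is not an eigenvalue the basis is empty and the same argument applies.
  · have hx' : (⟨x, hx⟩ : eigenspace Ω γ) ∈ Submodule.span ℝ (Set.range (v ⟨γ, hγ⟩)) := by
      rw [hspan]
      trivial
    have horth : ∀ y ∈ Submodule.span ℝ (Set.range (v ⟨γ, hγ⟩)),
        ⟪y, (⟨x, hx⟩ : eigenspace Ω γ)⟫_ℝ = 0 := by
      intro y hy
      induction hy using Submodule.span_induction with
      | mem y hy =>
        obtain ⟨i, rfl⟩ := hy
        have h1 := h0 ⟨i.1, hmem γ hγ i.1 i.2⟩
        refine Eq.trans ?_ h1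
        exact congrArg (⟪·, x⟫_ℝ) (hcongr ⟨i.1, hmem γ hγ i.1 i.2⟩ γ hγ i.2).symm
      | zero => simp
      | add y z _ _ hy hz => rw [inner_add_left, hy, hz, add_zero]
      | smul c y _ hy => rw [inner_smul_left, hy, mul_zero]
    exact congrArg Subtype.val (inner_self_eq_zero.mp (horth _ hx'))

end Eigenspaces

/-! ### Assembly of the gap bound and the comparison. -/

/-- The gap bound for the eigenvalues of the clamped plate problem, without denominators. -/
theorem IsEigenvalueSequence.gap_le {n : ℕ} {Ω : Set (E n)} (hΩ : IsOpen Ω)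
    (hb : Bornology.IsBounded Ω) {Γ : ℕ+ → ℝ} (hΓ : IsEigenvalueSequence Ω Γ) (m : ℕ+) :
    (Γ (m + 1) - Γ m) * ((n : ℝ) * ((m : ℕ) : ℝ)) ^ 2
      ≤ 8 * ((n : ℝ) + 2) * (∑ i ∈ Finset.Icc 1 m, √(Γ i)) ^ 2 := by
  -- Without a strict gap the left side is nonpositive; with one, the first m eigenfunctions exhaust
  -- all eigenvalues below Γ (m + 1).
  rcases le_or_gt (Γ (m + 1)) (Γ m) with hm | hm
  · refine le_trans (mul_nonpos_of_nonpos_of_nonneg (by linarith) (by positivity)) ?_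
    positivity
  obtain ⟨w, hw, hwe, hw0⟩ := hΓ.exists_eigenfunctions hm
  choose u huK huw hue using fun i => mem_eigenspace_iff.mp (hwe i)
  have hu : Orthonormal ℝ fun i => (u i).1 := by simpa only [huw] using hw
  have heig : ∀ i : ↥(Finset.Icc 1 m), ∀ J : jetSpace Ω, ⟪lap (u i), lap J.1⟫_ℝ = Γ i * ⟪(u i).1, J.1.1⟫_ℝ :=
    fun i J => hue i J.1 J.2
  have hf := memLp_coord hΩ hb
  have h := gap_le_of_commutator_identities (V := jetSpace Ω) (A := Γ m) (B := Γ (m + 1))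
    (ι := LinearMap.fst ℝ (L2 Ω) _ ∘ₗ (jetSpace Ω).subtype) (L := lap ∘ₗ (jetSpace Ω).subtype)
    (D := fun k => grad k ∘ₗ (jetSpace Ω).subtype)
    (X := fun k J => ⟨mulJet (hf k) J.1, mulJet_mem (hf k) J.2⟩)
    (u := fun i : ↥(Finset.Icc 1 m) => ⟨u i, huK i⟩) (μ := fun i : ↥(Finset.Icc 1 m) => Γ i) hu
    (fun k J J' => inner_mulL2 (hf k) _ _) (fun k J J' => inner_lap_mulJet (hf k) _ _)
    (fun k J => commutator_mulJet (hf k) J.2) (fun k J => inner_mulJet_grad (hf k) J.2)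
    (fun k J J' => inner_grad_left J.2 J'.2 k) (fun J => sum_norm_grad_sq_le J.2)
    heig
    (fun J hJ => mul_norm_sq_le_norm_lap_sq hb (u := fun i => ⟨u i, huK i⟩) hu heig
      (fun γ hγ x hx h0 => hw0 γ hγ x hx fun i => by rw [← huw]; exact h0 i) J.2 hJ)
    (fun i : ↥(Finset.Icc 1 m) => hΓ.monotone (Finset.mem_Icc.mp i.2).2) hm.le
  rw [Finset.sum_coe_sort (Finset.Icc 1 m) (fun i => √(Γ i))] at h
  simpa using h

end ClampedPlate

end

theorem mainTheorem4 (n : ℕ) (hn : 1 ≤ n) (Ω : Set (EuclideanSpace ℝ (Fin n)))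
    (hΩ_open : IsOpen Ω) (hΩ_conn : IsConnected Ω) (hΩ_bdd : Bornology.IsBounded Ω)
    (Γ : ℕ+ → ℝ) (hΓ : ClampedPlate.IsEigenvalueSequence Ω Γ) (m : ℕ+) :
    Γ (m + 1) - Γ m
        ≤ 8 * ((n : ℝ) + 2) / ((n : ℝ) ^ 2 * ((m : ℕ) : ℝ) ^ 2)
          * (∑ i ∈ Finset.Icc 1 m, √(Γ i)) ^ 2 ∧
      8 * ((n : ℝ) + 2) / ((n : ℝ) ^ 2 * ((m : ℕ) : ℝ) ^ 2)
          * (∑ i ∈ Finset.Icc 1 m, √(Γ i)) ^ 2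
        ≤ 8 * ((n : ℝ) + 2) / ((n : ℝ) ^ 2 * ((m : ℕ) : ℝ)) * ∑ i ∈ Finset.Icc 1 m, Γ i := by
  have hn0 : (0 : ℝ) < n := by exact_mod_cast hn
  have hm0 : (0 : ℝ) < (m : ℕ) := by exact_mod_cast m.pos
  constructor
  · rw [div_mul_eq_mul_div, le_div_iff₀ (by positivity), ← mul_pow]
    exact hΓ.gap_le hΩ_open hΩ_bdd m
  -- Cauchy–Schwarz against the constant 1; nonnegativity of Γ gives (√Γ_i)² = Γ_i.
  · have h := sq_sum_le_card_mul_sum_sq (s := Finset.Icc 1 m) (f := fun i => √(Γ i))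
    simp only [fun i => Real.sq_sqrt (hΓ.nonneg i), PNat.card_Icc] at h
    have hc : 8 * ((n : ℝ) + 2) / ((n : ℝ) ^ 2 * ((m : ℕ) : ℝ))
        = 8 * ((n : ℝ) + 2) / ((n : ℝ) ^ 2 * ((m : ℕ) : ℝ) ^ 2) * (m : ℕ) := by
      field_simp
    rw [hc, mul_assoc]
    refine mul_le_mul_of_nonneg_left ?_ (by positivity)
    simpa using h
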